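/- Let $n,m\ge 2$ be integers. For $i=1,\dots,n$ let $1>\mu_{i1}\ge\mu_{i2}\ge\cdots\ge\mu_{im}>0$ be real numbers, and let $X_1,\dots,X_n$ be independent random variables with $0\le X_i\le 1$ and $\mathbb{E}[X_i^k]=\mu_{ik}$ for all $i=1,\dots,n$ and $k=1,\dots,m$. For $s=1,\dots,m$ put $$q_s:=\frac1n\sum_{i=1}^n \mathbb{E}[X_i^s]^{1/s}.$$ Let $t$ be a positive integer with $nq_1<t<n$. For $j=1,\dots,m-1$ let $I_j:=(nq_j+1,\,nq_{j+1}+1]$, and let $I_m:=(nq_m+1,\,n)$. If $t\in I_j$ for some $j\in\{1,\dots,m\}$, then $$\mathbb{P}\Big[\sum_{i=1}^n X_i\ge t\Big]\le \min_{1\le s\le j}\ \left\{\frac{(st-s+1)(1-q_s)}{s\,(st-s+1-nsq_s)}\cdot \mathbb{P}\big[\mathrm{Bin}(ns,q_s)\ge st-s+1\big]\right\},$$ where $\mathrm{Bin}(ns,q_s)$ denotes a binomial random variable with $ns$ trials and success probability $q_s$. -/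

import Mathlib

open MeasureTheory ProbabilityTheory

/-- `X ∈ 𝓑(μ 1, …, μ m)`: `X` is a `[0,1]`-valued random variable on `(Ω, P)` whose `k`-th moment
equals `μ k` for `k = 1, …, m` (the values of `μ` outside `{1, …, m}` are irrelevant). -/
structure MemMomentClass {Ω : Type*} [MeasurableSpace Ω] (P : Measure Ω) (m : ℕ) (μ : ℕ → ℝ)
    (X : Ω → ℝ) : Prop where
  measurable : Measurable X
  mem_unit : ∀ᵐ ω ∂P, X ω ∈ Set.Icc (0 : ℝ) 1
  moment_eq : ∀ k ∈ Finset.Icc 1 m, ∫ ω, X ω ^ k ∂P = μ k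

/-- `q_s = (1/n) ∑ᵢ E[Xᵢ ^ s] ^ (1/s)`. -/
noncomputable def avgMomentRoot {Ω : Type*} [MeasurableSpace Ω] (P : Measure Ω) {n : ℕ}
    (X : Fin n → Ω → ℝ) (s : ℕ) : ℝ :=
  (1 / (n : ℝ)) * ∑ i, (∫ ω, X i ω ^ s ∂P) ^ (1 / (s : ℝ))

/-- The numbers `q_s` of `[0,1]`-valued random variables lie in `[0,1]`. -/
theorem avgMomentRoot_mem_unit {Ω : Type*} [MeasurableSpace Ω] (P : Measure Ω)
    [IsProbabilityMeasure P] {n : ℕ} (X : Fin n → Ω → ℝ)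
    (hX : ∀ i, ∀ᵐ ω ∂P, X i ω ∈ Set.Icc (0 : ℝ) 1) (s : ℕ) :
    avgMomentRoot P X s ∈ Set.Icc (0 : ℝ) 1 := by
  have h0 : ∀ i, 0 ≤ ∫ ω, X i ω ^ s ∂P := fun i =>
    integral_nonneg_of_ae ((hX i).mono fun ω h => pow_nonneg h.1 s)
  have h1 : ∀ i, ∫ ω, X i ω ^ s ∂P ≤ 1 := fun i => by
    have h := integral_mono_of_nonneg (μ := P) (f := fun ω => X i ω ^ s) (g := fun _ => (1 : ℝ))
      ((hX i).mono fun ω h => pow_nonneg h.1 s) (integrable_const _)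
      ((hX i).mono fun ω h => pow_le_one₀ h.1 h.2)
    simpa using h
  have hs : (0 : ℝ) ≤ 1 / (s : ℝ) := by positivity
  refine ⟨mul_nonneg (by positivity) (Finset.sum_nonneg fun i _ => Real.rpow_nonneg (h0 i) _), ?_⟩
  have hsum : ∑ i, (∫ ω, X i ω ^ s ∂P) ^ (1 / (s : ℝ)) ≤ ∑ _i : Fin n, (1 : ℝ) :=
    Finset.sum_le_sum fun i _ => Real.rpow_le_one (h0 i) (h1 i) hs
  simp only [Finset.sum_const, Finset.card_univ, Fintype.card_fin, nsmul_eq_mul, mul_one] at hsum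
  unfold avgMomentRoot
  rcases Nat.eq_zero_or_pos n with rfl | hn
  · simp
  · have hn' : (0 : ℝ) < n := by exact_mod_cast hn
    rw [one_div, inv_mul_le_iff₀ hn', mul_one]
    exact hsum

/-- `P[Bin(N, q) ≥ x]` for `q ∈ [0,1]`. The projection onto `[0,1]` only serves to turn the real
number `q` into an element of the unit interval; it leaves every `q ∈ [0,1]` unchanged. -/
noncomputable def binomialTail (N : ℕ) (q x : ℝ) : ℝ :=
  (binomial N (Set.projIcc (0 : ℝ) 1 zero_le_one q)).real {k : ℕ | x ≤ (k : ℝ)}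

/-- The interval `I_j`: it is `(n q_j + 1, n q_{j+1} + 1]` for `1 ≤ j ≤ m - 1`, and
`(n q_m + 1, n)` for `j = m`. -/
def momentInterval (n m : ℕ) (q : ℕ → ℝ) (j : ℕ) : Set ℝ :=
  if j < m then Set.Ioc ((n : ℝ) * q j + 1) ((n : ℝ) * q (j + 1) + 1)
  else Set.Ioo ((n : ℝ) * q m + 1) (n : ℝ)

/-! Fix `s`, and let `φ x = max (x - (t - 1)) 0`, which is at least 1 for `x ≥ t`. Markov's
inequality bounds the probability by `E[φ (∑ Xᵢ)]`. Put `pᵢ = E[Xᵢ ^ s] ^ (1/s)`. A convex `φ` lies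
below its Bernstein polynomial of degree `s`, and for monotone `φ` that polynomial is concave as a
function of `x ^ s`. Integrating its tangent at `pᵢ ^ s` therefore replaces `Xᵢ` by `Bin(s, pᵢ) / s`
(`integral_le_coeffPairing_bernoulliPGF_pow`). Independence carries this to the sum, and Hoeffding's
smoothing of the `n s` success probabilities (`coeffPairing_prod_le_pow`) leads to `Bin(n s, q_s) /
s`.

The mean excess of this binomial is compared with its tail through the ratio of consecutive weights
(`coeffPairing_excess_mul_le_binomialTail`). The condition `t ∈ I_j` with `q_s ≤ q_j` makes the
denominator positive for every `s ≤ j`. -/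

/-! ### Generating functions and Hoeffding's comparison. -/

open Polynomial in
/-- The pairing `∑ₖ Qₖ f k` of a sequence `f` with the coefficients of a polynomial `Q`. If `Q` is
the probability generating function of a random variable `N`, this is `E[f N]`. -/
noncomputable def coeffPairing (f : ℕ → ℝ) : ℝ[X] →ₗ[ℝ] ℝ :=
  Polynomial.lsum fun k => f k • LinearMap.id

/-- The probability generating function `(1 - p) + p X` of a Bernoulli variable. -/
noncomputable def bernoulliPGF (p : ℝ) : Polynomial ℝ :=
  Polynomial.C p * Polynomial.X + Polynomial.C (1 - p)

section PGF

open Polynomial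

theorem coeffPairing_eq_sum (f : ℕ → ℝ) (Q : ℝ[X]) :
    coeffPairing f Q = Q.sum fun k a => f k * a := by
  simp [coeffPairing, Polynomial.lsum_apply]

theorem coeffPairing_monomial (f : ℕ → ℝ) (k : ℕ) (a : ℝ) :
    coeffPairing f (monomial k a) = f k * a := by
  rw [coeffPairing_eq_sum, sum_monomial_index]
  simp

/-- Products of generating functions correspond to independent sums; this is Fubini for `E[f (M +
N)]`. -/
theorem coeffPairing_mul (f : ℕ → ℝ) (P Q : ℝ[X]) :
    coeffPairing f (P * Q) = coeffPairing (fun k => coeffPairing (fun l => f (k + l)) Q) P := by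
  induction P using Polynomial.induction_on' with
  | add P₁ P₂ h₁ h₂ => rw [add_mul, map_add, map_add, h₁, h₂]
  | monomial k a =>
    induction Q using Polynomial.induction_on' with
    | add Q₁ Q₂ h₁ h₂ =>
      rw [mul_add, map_add, h₁, h₂]
      simp only [coeffPairing_monomial, map_add]
      ring
    | monomial l b =>
      simp only [monomial_mul_monomial, coeffPairing_monomial]
      ring

theorem coeffPairing_mono {f g : ℕ → ℝ} {Q : ℝ[X]} (hQ : ∀ k, 0 ≤ Q.coeff k)
    (hfg : ∀ k, f k ≤ g k) : coeffPairing f Q ≤ coeffPairing g Q := by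
  rw [coeffPairing_eq_sum, coeffPairing_eq_sum]
  exact Finset.sum_le_sum fun k _ => mul_le_mul_of_nonneg_right (hfg k) (hQ k)

theorem coeffPairing_nonneg {f : ℕ → ℝ} {Q : ℝ[X]} (hQ : ∀ k, 0 ≤ Q.coeff k)
    (hf : ∀ k, 0 ≤ f k) : 0 ≤ coeffPairing f Q := by
  rw [coeffPairing_eq_sum]
  exact Finset.sum_nonneg fun k _ => mul_nonneg (hf k) (hQ k)

theorem integral_coeffPairing {α : Type*} [MeasurableSpace α] {ν : Measure α} {F : ℕ → α → ℝ}
    (hF : ∀ k, Integrable (F k) ν) (Q : ℝ[X]) :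
    ∫ x, coeffPairing (fun k => F k x) Q ∂ν = coeffPairing (fun k => ∫ x, F k x ∂ν) Q := by
  simp only [coeffPairing_eq_sum, Polynomial.sum]
  rw [integral_finsetSum _ fun k _ => (hF k).mul_const _]
  simp only [integral_mul_const]

theorem integrable_coeffPairing {α : Type*} [MeasurableSpace α] {ν : Measure α} {F : ℕ → α → ℝ}
    (hF : ∀ k, Integrable (F k) ν) (Q : ℝ[X]) :
    Integrable (fun x => coeffPairing (fun k => F k x) Q) ν := by
  simp only [coeffPairing_eq_sum, Polynomial.sum]
  exact integrable_finsetSum _ fun k _ => (hF k).mul_const _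

theorem coeff_mul_nonneg {P Q : ℝ[X]} (hP : ∀ k, 0 ≤ P.coeff k) (hQ : ∀ k, 0 ≤ Q.coeff k) (k : ℕ) :
    0 ≤ (P * Q).coeff k := by
  rw [coeff_mul]
  exact Finset.sum_nonneg fun x _ => mul_nonneg (hP _) (hQ _)

theorem coeff_one_nonneg (k : ℕ) : 0 ≤ (1 : ℝ[X]).coeff k := by
  rw [coeff_one]
  split_ifs <;> norm_num

theorem bernoulliPGF_coeff_nonneg {p : ℝ} (hp : p ∈ Set.Icc (0 : ℝ) 1) (k : ℕ) :
    0 ≤ (bernoulliPGF p).coeff k := by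
  rw [bernoulliPGF, coeff_add, coeff_C_mul, coeff_X, coeff_C]
  have h0 := hp.1
  have h1 := hp.2
  split_ifs <;> simp <;> linarith

theorem coeff_pow_nonneg {P : ℝ[X]} (hP : ∀ k, 0 ≤ P.coeff k) (s k : ℕ) : 0 ≤ (P ^ s).coeff k := by
  induction s generalizing k with
  | zero => simpa using coeff_one_nonneg k
  | succ s ih => exact pow_succ P s ▸ coeff_mul_nonneg ih hP k

theorem coeff_multiset_prod_nonneg {M : Multiset ℝ[X]} (hM : ∀ P ∈ M, ∀ k, 0 ≤ P.coeff k) (k : ℕ) :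
    0 ≤ M.prod.coeff k := by
  induction M using Multiset.induction_on generalizing k with
  | empty => simpa using coeff_one_nonneg k
  | cons P M ih =>
    rw [Multiset.prod_cons]
    exact coeff_mul_nonneg (hM P (Multiset.mem_cons_self P M))
      (fun k => ih (fun Q hQ => hM Q (Multiset.mem_cons_of_mem hQ)) k) k

theorem coeffPairing_bernoulliPGF_pow (f : ℕ → ℝ) (p : ℝ) (s : ℕ) :
    coeffPairing f (bernoulliPGF p ^ s) =
      ∑ k ∈ Finset.range (s + 1), (s.choose k * p ^ k * (1 - p) ^ (s - k)) * f k := by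
  rw [bernoulliPGF, add_pow, map_sum]
  refine Finset.sum_congr rfl fun k _ => ?_
  have : (C p * X) ^ k * C (1 - p) ^ (s - k) * (s.choose k : ℝ[X]) =
      monomial k (s.choose k * p ^ k * (1 - p) ^ (s - k)) := by
    rw [← C_mul_X_pow_eq_monomial]
    simp only [map_mul, map_pow, mul_pow, map_natCast]
    ring
  rw [this, coeffPairing_monomial, mul_comm]

/-- The difference is `(c - a) * (b - c) * (X - 1) ^ 2`, so pairing with `f` produces its second
differences. -/
theorem bernoulliPGF_mul_sub (a b c : ℝ) :
    bernoulliPGF c * bernoulliPGF (a + b - c) - bernoulliPGF a * bernoulliPGF b =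
      monomial 2 ((c - a) * (b - c)) + monomial 1 (-2 * ((c - a) * (b - c))) +
        monomial 0 ((c - a) * (b - c)) := by
  simp only [bernoulliPGF, ← C_mul_X_pow_eq_monomial, map_sub, map_add, map_mul, map_one, map_neg,
    map_ofNat]
  ring

/-- Moving two success probabilities closer to each other increases the mean of a convex function
of the number of successes. -/
theorem coeffPairing_smoothing {f : ℕ → ℝ} (hf : ∀ k, 0 ≤ f (k + 2) - 2 * f (k + 1) + f k)
    {R : ℝ[X]} (hR : ∀ k, 0 ≤ R.coeff k) {a b c : ℝ} (hac : a ≤ c) (hcb : c ≤ b) :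
    coeffPairing f (R * (bernoulliPGF a * bernoulliPGF b)) ≤
      coeffPairing f (R * (bernoulliPGF c * bernoulliPGF (a + b - c))) := by
  rw [← sub_nonneg, ← map_sub, ← mul_sub, bernoulliPGF_mul_sub, coeffPairing_mul]
  refine coeffPairing_nonneg hR fun k => ?_
  simp only [map_add, coeffPairing_monomial]
  have h := mul_nonneg (hf k) (mul_nonneg (sub_nonneg.2 hac) (sub_nonneg.2 hcb))
  simp only [add_zero]
  linarith

/-- Hoeffding's comparison of a sum of independent Bernoulli variables with the binomial variable of
the same mean, for convex functions. -/
theorem coeffPairing_prod_le_pow {f : ℕ → ℝ} (hf : ∀ k, 0 ≤ f (k + 2) - 2 * f (k + 1) + f k)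
    {c : ℝ} (hc : c ∈ Set.Icc (0 : ℝ) 1) (N : ℕ) (M : Multiset ℝ) (hcard : M.card = N)
    (hsum : M.sum = N * c) (hM : ∀ p ∈ M, p ∈ Set.Icc (0 : ℝ) 1) {R : ℝ[X]}
    (hR : ∀ k, 0 ≤ R.coeff k) :
    coeffPairing f (R * (M.map bernoulliPGF).prod) ≤ coeffPairing f (R * bernoulliPGF c ^ N) := by
  induction N generalizing M R with
  | zero => simp [Multiset.card_eq_zero.1 hcard]
  | succ N ih =>
    obtain ⟨a, haM, hac⟩ : ∃ a ∈ M, a ≤ c := by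
      by_contra! h
      have hne : M ≠ 0 := by rintro rfl; simp at hcard
      have := Multiset.sum_lt_sum_of_nonempty (f := fun _ => c) (g := id) hne fun x hx => h x hx
      simp [hcard, hsum] at this
      linarith
    obtain ⟨M₁, rfl⟩ := Multiset.exists_cons_of_mem haM
    have hcard₁ : M₁.card = N := by simpa using hcard
    rw [Multiset.sum_cons] at hsum
    push_cast at hsum
    rcases Nat.eq_zero_or_pos N with rfl | hN
    · obtain rfl := Multiset.card_eq_zero.1 hcard₁
      have : a = c := by simpa using hsum
      simp [this]
    obtain ⟨b, hbM, hcb⟩ : ∃ b ∈ M₁, c ≤ b := by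
      by_contra! h
      have hne : M₁ ≠ 0 := by rintro rfl; simp at hcard₁; omega
      have := Multiset.sum_lt_sum_of_nonempty (f := id) (g := fun _ => c) hne fun x hx => h x hx
      simp [hcard₁] at this
      linarith
    obtain ⟨M₂, rfl⟩ := Multiset.exists_cons_of_mem hbM
    have ha := hM a (by simp)
    have hb := hM b (by simp)
    rw [Multiset.sum_cons] at hsum
    have hM₂ : ∀ P ∈ M₂.map bernoulliPGF, ∀ k, 0 ≤ P.coeff k := by
      intro P hP
      obtain ⟨p, hp, rfl⟩ := Multiset.mem_map.1 hP
      exact bernoulliPGF_coeff_nonneg (hM p (by simp [hp]))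
    have h₁ := coeffPairing_smoothing hf (coeff_mul_nonneg hR (coeff_multiset_prod_nonneg hM₂))
      hac hcb
    -- The pair `a, b` has become `c, a + b - c`. The factor for `c` is moved into `R`, and the
    -- remaining `N` probabilities still have mean `c`.
    have h₂ := ih ((a + b - c) ::ₘ M₂) (by simpa using hcard₁)
      (by rw [Multiset.sum_cons]; linarith)
      (by
        intro p hp
        rcases Multiset.mem_cons.1 hp with rfl | hp
        · exact ⟨by linarith [ha.1], by linarith [hb.2]⟩
        · exact hM p (by simp [hp]))
      (coeff_mul_nonneg hR (bernoulliPGF_coeff_nonneg hc))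
    simp only [Multiset.map_cons, Multiset.prod_cons] at h₂ ⊢
    refine le_trans (le_of_eq ?_) ((h₁.trans (le_of_eq ?_)).trans (h₂.trans (le_of_eq ?_)))
    · congr 1; ring
    · congr 1; ring
    · congr 1; ring

end PGF

/-! ### Bernstein polynomials and the domination of a single variable. -/

theorem coeffPairing_add_mul (f g : ℕ → ℝ) (c : ℝ) (Q : Polynomial ℝ) :
    coeffPairing (fun k => f k + c * g k) Q = coeffPairing f Q + c * coeffPairing g Q := by
  simp only [coeffPairing_eq_sum, Polynomial.sum, Finset.mul_sum]
  rw [← Finset.sum_add_distrib]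
  exact Finset.sum_congr rfl fun k _ => by ring

/-- Conditioning on the last of `s + 1` trials. -/
theorem coeffPairing_bernoulliPGF_pow_succ (f : ℕ → ℝ) (x : ℝ) (s : ℕ) :
    coeffPairing f (bernoulliPGF x ^ (s + 1)) = coeffPairing f (bernoulliPGF x ^ s) +
      x * coeffPairing (fun k => f (k + 1) - f k) (bernoulliPGF x ^ s) := by
  rw [pow_succ, coeffPairing_mul, ← coeffPairing_add_mul]
  congr 2
  funext k
  rw [← pow_one (bernoulliPGF x), coeffPairing_bernoulliPGF_pow]
  simp [Finset.sum_range_succ]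
  ring

theorem coeffPairing_bernoulliPGF_pow_zero (f : ℕ → ℝ) (x : ℝ) :
    coeffPairing f (bernoulliPGF x ^ 0) = f 0 := by
  rw [coeffPairing_bernoulliPGF_pow]
  simp

theorem hasDerivAt_coeffPairing_bernoulliPGF_pow (f : ℕ → ℝ) (s : ℕ) (x : ℝ) :
    HasDerivAt (fun x => coeffPairing f (bernoulliPGF x ^ (s + 1)))
      ((s + 1) * coeffPairing (fun k => f (k + 1) - f k) (bernoulliPGF x ^ s)) x := by
  induction s generalizing f with
  | zero =>
    simp only [coeffPairing_bernoulliPGF_pow_succ _ _ 0, coeffPairing_bernoulliPGF_pow_zero]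
    simpa using ((hasDerivAt_id x).mul_const (f 1 - f 0)).const_add (f 0)
  | succ s ih =>
    have h := (ih f).add ((hasDerivAt_id x).mul (ih fun k => f (k + 1) - f k))
    simp only [coeffPairing_bernoulliPGF_pow_succ _ _ (s + 1)]
    refine h.congr_deriv ?_
    have e := coeffPairing_bernoulliPGF_pow_succ (fun k => f (k + 1) - f k) x s
    simp only [id] at e ⊢
    push_cast
    rw [e]
    ring

theorem sum_binomial_weights (s : ℕ) (x : ℝ) :
    ∑ k ∈ Finset.range (s + 1), (s.choose k * x ^ k * (1 - x) ^ (s - k)) = 1 := by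
  have h := add_pow x (1 - x) s
  rw [add_sub_cancel, one_pow] at h
  exact (Finset.sum_congr rfl fun k _ => by ring).trans h.symm

theorem sum_binomial_weights_mul (s : ℕ) (x : ℝ) :
    ∑ k ∈ Finset.range (s + 1), (s.choose k * x ^ k * (1 - x) ^ (s - k)) * (k : ℝ) = s * x := by
  rw [← coeffPairing_bernoulliPGF_pow (fun k => (k : ℝ))]
  induction s with
  | zero => simp only [coeffPairing_bernoulliPGF_pow_zero, Nat.cast_zero, zero_mul]
  | succ s ih =>
    rw [coeffPairing_bernoulliPGF_pow_succ, ih, coeffPairing_bernoulliPGF_pow]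
    simp only [Nat.cast_succ, add_sub_cancel_left, mul_one, sum_binomial_weights]
    ring

theorem binomial_weight_nonneg {x : ℝ} (hx : x ∈ Set.Icc (0 : ℝ) 1) (s k : ℕ) :
    0 ≤ s.choose k * x ^ k * (1 - x) ^ (s - k) := by
  have h0 := hx.1
  have h1 := sub_nonneg.2 hx.2
  positivity

/-- A convex function lies below its Bernstein polynomials. -/
theorem ConvexOn.le_coeffPairing_bernoulliPGF_pow {φ : ℝ → ℝ} (hφ : ConvexOn ℝ Set.univ φ) {s : ℕ}
    (hs : s ≠ 0) {x : ℝ} (hx : x ∈ Set.Icc (0 : ℝ) 1) :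
    φ x ≤ coeffPairing (fun k => φ (k / s)) (bernoulliPGF x ^ s) := by
  have h := hφ.map_sum_le (t := Finset.range (s + 1)) (p := fun k : ℕ => (k / s : ℝ))
    (fun k _ => binomial_weight_nonneg hx s k) (sum_binomial_weights s x) (fun _ _ => Set.mem_univ _)
  rw [coeffPairing_bernoulliPGF_pow]
  simp only [smul_eq_mul, mul_div_assoc'] at h
  rw [← Finset.sum_div, sum_binomial_weights_mul, mul_div_cancel_left₀ _ (Nat.cast_ne_zero.2 hs)] at h
  exact h

/-- For `f` nondecreasing, `D(x) / x ^ s` is nonincreasing, where `D` is the Bernstein polynomial of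
the increments of `f`. -/
theorem coeffPairing_mul_pow_le {f : ℕ → ℝ} (hf : ∀ k, 0 ≤ f k) (s : ℕ) {x y : ℝ}
    (hx : 0 ≤ x) (hxy : x ≤ y) (hy : y ≤ 1) :
    coeffPairing f (bernoulliPGF y ^ s) * x ^ s ≤ coeffPairing f (bernoulliPGF x ^ s) * y ^ s := by
  rw [coeffPairing_bernoulliPGF_pow, coeffPairing_bernoulliPGF_pow, Finset.sum_mul, Finset.sum_mul]
  refine Finset.sum_le_sum fun k hk => ?_
  have hk : k ≤ s := Nat.lt_succ_iff.1 (Finset.mem_range.1 hk)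
  have h : ((1 - y) * x) ^ (s - k) ≤ ((1 - x) * y) ^ (s - k) :=
    pow_le_pow_left₀ (mul_nonneg (by linarith) hx) (by nlinarith) _
  have hc : 0 ≤ s.choose k * (x * y) ^ k * f k :=
    mul_nonneg (mul_nonneg (by positivity) (pow_nonneg (mul_nonneg hx (hx.trans hxy)) _)) (hf k)
  have hz : ∀ z : ℝ, z ^ s = z ^ k * z ^ (s - k) := fun z => by
    rw [← pow_add, Nat.add_sub_cancel' hk]
  refine le_trans (le_of_eq ?_) ((mul_le_mul_of_nonneg_left h hc).trans (le_of_eq ?_))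
  · rw [hz x, mul_pow, mul_pow]; ring
  · rw [hz y, mul_pow, mul_pow]; ring

/-- The Bernstein polynomial of a nondecreasing sequence, as a function of `x ^ (s + 1)`, lies below
its tangent at `p ^ (s + 1)`. -/
theorem coeffPairing_bernoulliPGF_pow_le_tangent {f : ℕ → ℝ} (hf : Monotone f) (s : ℕ) {p x : ℝ}
    (hp : p ∈ Set.Icc (0 : ℝ) 1) (hx : x ∈ Set.Icc (0 : ℝ) 1) :
    coeffPairing f (bernoulliPGF x ^ (s + 1)) * p ^ s ≤
      coeffPairing f (bernoulliPGF p ^ (s + 1)) * p ^ s +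
      coeffPairing (fun k => f (k + 1) - f k) (bernoulliPGF p ^ s) * (x ^ (s + 1) - p ^ (s + 1)) := by
  set D : ℝ → ℝ := fun y => coeffPairing (fun k => f (k + 1) - f k) (bernoulliPGF y ^ s) with hD
  -- The claim is that `h` is maximal at `p`. Since `D y / y ^ s` is nonincreasing, `h` increases up
  -- to `p` and decreases after it; the factor `p ^ s` avoids dividing.
  set h : ℝ → ℝ := fun y => coeffPairing f (bernoulliPGF y ^ (s + 1)) * p ^ s - D p * y ^ (s + 1)
    with hh
  have hΔ : ∀ k, 0 ≤ f (k + 1) - f k := fun k => sub_nonneg.2 (hf (Nat.le_succ k))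
  have hd : ∀ y, HasDerivAt h ((s + 1) * (D y * p ^ s - D p * y ^ s)) y := fun y => by
    have h₁ := (hasDerivAt_coeffPairing_bernoulliPGF_pow f s y).mul_const (p ^ s)
    have h₂ := (hasDerivAt_pow (s + 1) y).const_mul (D p)
    refine (h₁.sub h₂).congr_deriv ?_
    simp only [hD, Nat.add_sub_cancel]
    push_cast
    ring
  have hcont : Continuous h := continuous_iff_continuousAt.2 fun y => (hd y).continuousAt
  suffices h x ≤ h p by
    simp only [hh] at this
    change _ ≤ _ + D p * _
    linarith
  have hs : (0 : ℝ) ≤ s + 1 := by positivity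
  rcases le_total x p with hxp | hpx
  · refine monotoneOn_of_deriv_nonneg (convex_Icc 0 p) hcont.continuousOn
      (fun y _ => (hd y).differentiableAt.differentiableWithinAt) (fun y hy => ?_)
      ⟨hx.1, hxp⟩ ⟨hp.1, le_rfl⟩ hxp
    rw [interior_Icc] at hy
    rw [(hd y).deriv]
    exact mul_nonneg hs (sub_nonneg.2 (coeffPairing_mul_pow_le hΔ s hy.1.le hy.2.le hp.2))
  · refine antitoneOn_of_deriv_nonpos (convex_Icc p 1) hcont.continuousOn
      (fun y _ => (hd y).differentiableAt.differentiableWithinAt) (fun y hy => ?_)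
      ⟨le_rfl, hp.2⟩ ⟨hpx, hx.2⟩ hpx
    rw [interior_Icc] at hy
    rw [(hd y).deriv]
    exact mul_nonpos_of_nonneg_of_nonpos hs
      (sub_nonpos.2 (coeffPairing_mul_pow_le hΔ s hp.1 hy.1.le hy.2.le))

theorem Monotone.integrable_comp_of_mem_Icc {Ω : Type*} [MeasurableSpace Ω] {P : Measure Ω}
    [IsFiniteMeasure P] {φ : ℝ → ℝ} (hφ : Monotone φ) {Y : Ω → ℝ} (hY : Measurable Y) {a b : ℝ}
    (hab : ∀ᵐ ω ∂P, Y ω ∈ Set.Icc a b) : Integrable (fun ω => φ (Y ω)) P :=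
  Integrable.of_mem_Icc (φ a) (φ b) (hφ.measurable.comp hY).aemeasurable
    (hab.mono fun _ h => ⟨hφ h.1, hφ h.2⟩)

/-- A `[0,1]`-valued variable with `E[X ^ s] = p ^ s` is dominated by `Bin(s, p) / s` for
nondecreasing convex functions. -/
theorem integral_le_coeffPairing_bernoulliPGF_pow {Ω : Type*} [MeasurableSpace Ω] {P : Measure Ω}
    [IsProbabilityMeasure P] {φ : ℝ → ℝ} (hφ : ConvexOn ℝ Set.univ φ) (hmono : Monotone φ)
    {X : Ω → ℝ} (hX : Measurable X) (hX01 : ∀ᵐ ω ∂P, X ω ∈ Set.Icc (0 : ℝ) 1) {s : ℕ} (hs : s ≠ 0)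
    {p : ℝ} (hp : p ∈ Set.Ioc (0 : ℝ) 1) (hmoment : ∫ ω, X ω ^ s ∂P = p ^ s) :
    ∫ ω, φ (X ω) ∂P ≤ coeffPairing (fun k => φ (k / s)) (bernoulliPGF p ^ s) := by
  obtain ⟨r, rfl⟩ := Nat.exists_eq_succ_of_ne_zero hs
  rw [Nat.succ_eq_add_one] at hmoment ⊢
  set f : ℕ → ℝ := fun k => φ (k / (r + 1 : ℕ))
  have hf : Monotone f := fun a b hab => hmono (by gcongr)
  set G := coeffPairing f (bernoulliPGF p ^ (r + 1))
  set D := coeffPairing (fun k => f (k + 1) - f k) (bernoulliPGF p ^ r)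
  have hpr : 0 < p ^ r := pow_pos hp.1 r
  have hpow : Integrable (fun ω => X ω ^ (r + 1)) P :=
    Integrable.of_mem_Icc 0 1 (hX.pow_const _).aemeasurable
      (hX01.mono fun _ h => ⟨pow_nonneg h.1 _, pow_le_one₀ h.1 h.2⟩)
  have hdiff : Integrable (fun ω => X ω ^ (r + 1) - p ^ (r + 1)) P := hpow.sub (integrable_const _)
  -- The moment condition makes the linear term of the tangent integrate to zero.
  have hle : ∫ ω, φ (X ω) * p ^ r ∂P ≤ ∫ ω, (G * p ^ r + D * (X ω ^ (r + 1) - p ^ (r + 1))) ∂P := by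
    refine integral_mono_ae ((hmono.integrable_comp_of_mem_Icc hX hX01).mul_const _)
      ((integrable_const _).add (hdiff.const_mul _)) ?_
    filter_upwards [hX01] with ω hω
    exact (mul_le_mul_of_nonneg_right (hφ.le_coeffPairing_bernoulliPGF_pow hs hω) hpr.le).trans
      (coeffPairing_bernoulliPGF_pow_le_tangent hf r ⟨hp.1.le, hp.2⟩ hω)
  rw [integral_mul_const, integral_add (integrable_const _)
    (hdiff.const_mul _), integral_const_mul D,
    integral_sub hpow (integrable_const _), hmoment] at hle
  simp only [integral_const, probReal_univ, one_smul, sub_self, mul_zero, add_zero] at hle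
  exact le_of_mul_le_mul_right hle hpr

/-! ### Domination for independent sums. -/

/-- The domination by binomial variables passes to sums of independent variables. -/
theorem integral_sum_le_coeffPairing_prod {Ω ι : Type*} [MeasurableSpace Ω]
    {P : Measure Ω} [IsProbabilityMeasure P] {φ : ℝ → ℝ} (hφ : ConvexOn ℝ Set.univ φ)
    (hmono : Monotone φ) {X : ι → Ω → ℝ} (hX : ∀ i, Measurable (X i))
    (hX01 : ∀ i, ∀ᵐ ω ∂P, X i ω ∈ Set.Icc (0 : ℝ) 1) (hindep : iIndepFun X P) {s : ℕ} (hs : s ≠ 0)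
    {p : ι → ℝ} (hp : ∀ i, p i ∈ Set.Ioc (0 : ℝ) 1) (hmoment : ∀ i, ∫ ω, X i ω ^ s ∂P = p i ^ s)
    (S : Finset ι) (y : ℝ) :
    ∫ ω, φ (∑ i ∈ S, X i ω + y) ∂P ≤
      coeffPairing (fun k => φ (k / s + y)) (∏ i ∈ S, bernoulliPGF (p i) ^ s) := by
  classical
  -- The shift `y` must vary: with `X i` frozen at `x`, the induction hypothesis is used at `x + y`.
  induction S using Finset.induction_on generalizing y with
  | empty =>
    have h := coeffPairing_bernoulliPGF_pow_zero (fun k => φ (k / s + y)) 0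
    rw [pow_zero] at h
    simp [h]
  | insert i S hi ih =>
    set Y : Ω → ℝ := fun ω => ∑ i ∈ S, X i ω with hYdef
    have hY : Measurable Y := Finset.measurable_sum _ fun i _ => hX i
    have hYS : ∀ᵐ ω ∂P, Y ω ∈ Set.Icc (0 : ℝ) (∑ _i ∈ S, 1) := by
      filter_upwards [(Finset.eventually_all S).2 fun i _ => hX01 i] with ω hω
      exact ⟨Finset.sum_nonneg fun i hi => (hω i hi).1, Finset.sum_le_sum fun i hi => (hω i hi).2⟩
    have hXY : IndepFun (X i) Y P := by
      have h := (hindep.indepFun_finsetSum_of_notMem hX hi).symm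
      convert h using 1
      funext ω
      simp [hYdef]
    set Q := ∏ i ∈ S, bernoulliPGF (p i) ^ s
    have hQ : ∀ k, 0 ≤ Q.coeff k :=
      coeff_multiset_prod_nonneg fun R hR => by
        obtain ⟨i, -, rfl⟩ := Multiset.mem_map.1 hR
        exact coeff_pow_nonneg (bernoulliPGF_coeff_nonneg ⟨(hp i).1.le, (hp i).2⟩) s
    have hshift : ∀ a, Integrable (fun ω => φ (a + (X i ω + y))) P := fun a =>
      Monotone.integrable_comp_of_mem_Icc (φ := fun x => φ (a + (x + y)))
        (fun u v huv => hmono (by linarith)) (hX i) (hX01 i)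
    have hmeas : Measurable fun z : ℝ × ℝ => φ (z.2 + (z.1 + y)) :=
      hmono.measurable.comp (by fun_prop)
    have hint : Integrable (fun ω => φ (Y ω + (X i ω + y))) P := by
      refine hmono.integrable_comp_of_mem_Icc (a := y) (b := ∑ _i ∈ S, 1 + (1 + y))
        (hY.add ((hX i).add_const y)) ?_
      filter_upwards [hX01 i, hYS] with ω h₁ h₂
      exact ⟨by linarith [h₁.1, h₂.1], by linarith [h₁.2, h₂.2]⟩
    have hpair : P.map (fun ω => (X i ω, Y ω)) = (P.map (X i)).prod (P.map Y) :=
      (indepFun_iff_map_prod_eq_prod_map_map (hX i).aemeasurable hY.aemeasurable).1 hXY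
    have hXYm : Measurable fun ω => (X i ω, Y ω) := (hX i).prodMk hY
    have := Measure.isProbabilityMeasure_map (μ := P) (hX i).aemeasurable
    have := Measure.isProbabilityMeasure_map (μ := P) hY.aemeasurable
    have hintp : Integrable (fun z : ℝ × ℝ => φ (z.2 + (z.1 + y)))
        ((P.map (X i)).prod (P.map Y)) := by
      rw [← hpair, integrable_map_measure hmeas.aestronglyMeasurable hXYm.aemeasurable]
      exact hint
    have hmeas₁ : ∀ a, Measurable fun x : ℝ => φ (a + (x + y)) := fun a =>
      hmono.measurable.comp (by fun_prop)
    have hmeas₂ : ∀ x, Measurable fun v : ℝ => φ (v + (x + y)) := fun x =>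
      hmono.measurable.comp (by fun_prop)
    have hmapint : ∀ a, Integrable (fun x => φ (a + (x + y))) (P.map (X i)) := fun a => by
      rw [integrable_map_measure (hmeas₁ a).aestronglyMeasurable (hX i).aemeasurable]
      exact hshift a
    calc ∫ ω, φ (∑ j ∈ insert i S, X j ω + y) ∂P
        = ∫ ω, φ (Y ω + (X i ω + y)) ∂P := by
          simp only [Finset.sum_insert hi, hYdef]
          congr 1
          funext ω
          congr 1
          ring
      _ = ∫ x, ∫ v, φ (v + (x + y)) ∂(P.map Y) ∂(P.map (X i)) := by
          rw [← integral_prod _ hintp, ← hpair,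
            integral_map hXYm.aemeasurable hmeas.aestronglyMeasurable]
      _ ≤ ∫ x, coeffPairing (fun k => φ (k / s + (x + y))) Q ∂(P.map (X i)) := by
          refine integral_mono hintp.integral_prod_left
            (integrable_coeffPairing (fun k => hmapint (k / s)) Q) fun x => ?_
          change ∫ v, φ (v + (x + y)) ∂(P.map Y) ≤ _
          rw [integral_map hY.aemeasurable (hmeas₂ x).aestronglyMeasurable]
          exact ih (x + y)
      _ = coeffPairing (fun k : ℕ => ∫ ω, φ (k / s + (X i ω + y)) ∂P) Q := by
          rw [integral_coeffPairing (fun k : ℕ => hmapint (k / s)) Q]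
          congr 2
          funext k
          exact integral_map (hX i).aemeasurable (hmeas₁ _).aestronglyMeasurable
      -- The other variables are now binomial. For each fixed `k` the translate of `φ` is again
      -- nondecreasing and convex, so `X i` can be replaced too.
      _ ≤ coeffPairing (fun k : ℕ => coeffPairing (fun l : ℕ => φ ((k + l : ℕ) / s + y))
            (bernoulliPGF (p i) ^ s)) Q := by
          refine coeffPairing_mono hQ fun k => ?_
          have hφk : ConvexOn ℝ Set.univ fun x => φ (k / s + y + x) := by
            have := hφ.translate_right (k / s + y : ℝ)
            simpa [Function.comp_def] using this
          have h := integral_le_coeffPairing_bernoulliPGF_pow hφk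
            (fun u v huv => hmono (by linarith)) (hX i) (hX01 i) hs (hp i) (hmoment i)
          refine le_trans (le_of_eq ?_) (h.trans (le_of_eq ?_))
          · congr 1; funext ω; congr 1; ring
          · congr 2; funext l; congr 1; push_cast; ring
      _ = coeffPairing (fun k => φ (k / s + y)) (∏ j ∈ insert i S, bernoulliPGF (p j) ^ s) := by
          rw [Finset.prod_insert hi, mul_comm, coeffPairing_mul]

/-! ### Mean excess and tail of a binomial variable. -/

theorem binomialTail_eq_sum {N : ℕ} {q : ℝ} (hq : q ∈ Set.Icc (0 : ℝ) 1) (T : ℕ) :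
    binomialTail N q T = ∑ k ∈ Finset.range (N + 1),
      (N.choose k * q ^ k * (1 - q) ^ (N - k)) * (if T ≤ k then 1 else 0) := by
  have h : binomialTail N q T = ∫ k, ({k : ℕ | T ≤ k}.indicator (fun _ => (1 : ℝ))) k
      ∂(binomial N (Set.projIcc (0 : ℝ) 1 zero_le_one q)) := by
    rw [integral_indicator_const _ MeasurableSet.of_discrete]
    simp [binomialTail]
  rw [h, integral_binomial, Set.projIcc_of_mem _ hq]
  simp only [smul_eq_mul, Set.indicator_apply, Set.mem_ofPred_eq]
  exact Finset.sum_congr (by ext; simp) fun _ _ => rfl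

theorem binomial_weight_succ (N k : ℕ) (hk : k ≤ N) (q : ℝ) :
    (k + 1) * (1 - q) * (N.choose (k + 1) * q ^ (k + 1) * (1 - q) ^ (N - (k + 1))) =
      (N - k) * q * (N.choose k * q ^ k * (1 - q) ^ (N - k)) := by
  have hc : (N.choose (k + 1) : ℝ) * (k + 1) = N.choose k * (N - k) := by
    have := Nat.choose_succ_right_eq N k
    rw [← Nat.cast_sub hk]
    exact_mod_cast this
  rcases hk.eq_or_lt with rfl | hk
  · simp
  · obtain ⟨d, hd⟩ : ∃ d, N - k = d + 1 := ⟨N - k - 1, by omega⟩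
    have hd' : N - (k + 1) = d := by omega
    rw [hd, hd', pow_succ, pow_succ]
    linear_combination q ^ k * q * (1 - q) ^ d * (1 - q) * hc

/-- The mean excess of a binomial variable over `T - 1`, bounded through the ratio of consecutive
weights by its tail at `T`. -/
theorem coeffPairing_excess_mul_le_binomialTail {N T : ℕ} {q : ℝ} (hq : q ∈ Set.Icc (0 : ℝ) 1) :
    coeffPairing (fun k => max (k + 1 - T : ℝ) 0) (bernoulliPGF q ^ N) * (T - N * q) ≤
      T * (1 - q) * binomialTail N q T := by
  set w : ℕ → ℝ := fun k => N.choose k * q ^ k * (1 - q) ^ (N - k) with hw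
  have hw0 : ∀ k, 0 ≤ w k := fun k => binomial_weight_nonneg hq N k
  have hq1 : 0 ≤ 1 - q := sub_nonneg.2 hq.2
  rw [coeffPairing_bernoulliPGF_pow, binomialTail_eq_sum hq]
  set W := ∑ k ∈ Finset.range (N + 1), w k * max (k + 1 - T : ℝ) 0 with hW
  set R := ∑ k ∈ Finset.range (N + 1), w k * (if T ≤ k then 1 else 0) with hR
  -- An index shift, combined with `(k + 1 - T)⁺ - (k - T)⁺ = 1` for `k ≥ T` and `0` otherwise.
  have hrec : ∑ k ∈ Finset.range (N + 1), w (k + 1) * max (k + 1 - T : ℝ) 0 = W - R := by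
    have h₁ : W - R = ∑ k ∈ Finset.range (N + 1), w k * max (k - T : ℝ) 0 := by
      rw [hW, hR, ← Finset.sum_sub_distrib]
      refine Finset.sum_congr rfl fun k _ => ?_
      rw [← mul_sub]
      congr 1
      split_ifs with h
      · have : (T : ℝ) ≤ k := by exact_mod_cast h
        rw [max_eq_left (by linarith), max_eq_left (by linarith)]
        ring
      · have : (k : ℝ) + 1 ≤ T := by exact_mod_cast (not_le.1 h)
        rw [max_eq_right (by linarith), max_eq_right (by linarith)]
        ring
    have h₂ : w (N + 1) = 0 := by simp [hw]
    have h₃ := Finset.sum_range_succ (fun k : ℕ => w k * max (k - T : ℝ) 0) (N + 1)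
    have h₄ := Finset.sum_range_succ' (fun k : ℕ => w k * max (k - T : ℝ) 0) (N + 1)
    have h₅ : max ((0 : ℕ) - T : ℝ) 0 = 0 := max_eq_right (by simp)
    rw [h₅, h₃, h₂] at h₄
    rw [h₁]
    push_cast at h₄
    linarith
  -- Only `k ≥ T` contributes, where `T ≤ k + 1` and `N - k ≤ N - T` bound the weight ratio. With
  -- `hrec` this reads `T (1 - q) (W - R) ≤ (N - T) q W`, which rearranges to the claim.
  have hratio : T * (1 - q) * ∑ k ∈ Finset.range (N + 1), w (k + 1) * max (k + 1 - T : ℝ) 0 ≤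
      (N - T) * q * W := by
    rw [hW, Finset.mul_sum, Finset.mul_sum]
    refine Finset.sum_le_sum fun k hk => ?_
    have hkN : k ≤ N := Nat.lt_succ_iff.1 (Finset.mem_range.1 hk)
    rw [← mul_assoc _ (w (k + 1)), ← mul_assoc _ (w k)]
    rcases lt_or_ge k T with h | h
    · have : (k : ℝ) + 1 ≤ T := by exact_mod_cast h
      rw [max_eq_right (by linarith : (k : ℝ) + 1 - T ≤ 0), mul_zero, mul_zero]
    · have hTk : (T : ℝ) ≤ k := by exact_mod_cast h
      have h₁ : T * (1 - q) * w (k + 1) ≤ (k + 1) * (1 - q) * w (k + 1) :=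
        mul_le_mul_of_nonneg_right (mul_le_mul_of_nonneg_right (by linarith) hq1) (hw0 _)
      have h₂ : (N - k) * q * w k ≤ (N - T) * q * w k :=
        mul_le_mul_of_nonneg_right (mul_le_mul_of_nonneg_right (by linarith) hq.1) (hw0 _)
      exact mul_le_mul_of_nonneg_right
        (h₁.trans ((binomial_weight_succ N k hkN q).le.trans h₂)) (le_max_right _ _)
  rw [hrec] at hratio
  linarith

/-! ### Monotonicity of `q_s` and assembly of the bound. -/

/-- Jensen's inequality for `x ^ (j / s)` applied to `X ^ s`; it yields `q_s ≤ q_j`. -/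
theorem integral_pow_rpow_one_div_mono {Ω : Type*} [MeasurableSpace Ω] {P : Measure Ω}
    [IsProbabilityMeasure P] {X : Ω → ℝ} (hX : Measurable X)
    (hX01 : ∀ᵐ ω ∂P, X ω ∈ Set.Icc (0 : ℝ) 1) {s j : ℕ} (hs : 1 ≤ s) (hsj : s ≤ j) :
    (∫ ω, X ω ^ s ∂P) ^ (1 / (s : ℝ)) ≤ (∫ ω, X ω ^ j ∂P) ^ (1 / (j : ℝ)) := by
  have hs0 : (0 : ℝ) < s := by exact_mod_cast hs
  have hj0 : (0 : ℝ) < j := by exact_mod_cast hs.trans hsj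
  have hint : ∀ k, Integrable (fun ω => X ω ^ k) P := fun k =>
    Integrable.of_mem_Icc 0 1 (hX.pow_const _).aemeasurable
      (hX01.mono fun _ h => ⟨pow_nonneg h.1 _, pow_le_one₀ h.1 h.2⟩)
  have hnn : ∀ k, 0 ≤ ∫ ω, X ω ^ k ∂P := fun k =>
    integral_nonneg_of_ae (hX01.mono fun ω h => pow_nonneg h.1 k)
  have hpow : ∀ᵐ ω ∂P, (X ω ^ s) ^ ((j : ℝ) / s) = X ω ^ j := by
    filter_upwards [hX01] with ω hω
    rw [← Real.rpow_natCast, ← Real.rpow_mul hω.1, mul_div_cancel₀ _ hs0.ne', Real.rpow_natCast]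
  have hr : (1 : ℝ) ≤ (j : ℝ) / s := (one_le_div hs0).2 (by exact_mod_cast hsj)
  have hjensen := (convexOn_rpow hr).map_integral_le (μ := P) (f := fun ω => X ω ^ s)
    (continuousOn_id.rpow_const fun _ _ => Or.inr (by positivity)) isClosed_Ici
    (hX01.mono fun ω h => pow_nonneg h.1 s) (hint s) ((hint j).congr (hpow.mono fun _ h => h.symm))
  rw [integral_congr_ae hpow] at hjensen
  have h := Real.rpow_le_rpow (Real.rpow_nonneg (hnn s) _) hjensen
    (by positivity : (0 : ℝ) ≤ 1 / j)
  rw [← Real.rpow_mul (hnn s)] at h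
  convert h using 2
  field_simp

theorem convexOn_max_sub_zero (a : ℝ) : ConvexOn ℝ Set.univ fun x : ℝ => max (x - a) 0 :=
  ((convexOn_id convex_univ).sub (concaveOn_const a convex_univ)).sup (convexOn_const 0 convex_univ)

/-- `P[∑ Xᵢ ≥ t] ≤ E[(Bin(n s, q_s) / s - (t - 1))⁺]`. -/
theorem prob_sum_ge_le_coeffPairing {Ω : Type*} [MeasurableSpace Ω] {P : Measure Ω}
    [IsProbabilityMeasure P] {n : ℕ} (hn : n ≠ 0) {X : Fin n → Ω → ℝ} (hX : ∀ i, Measurable (X i))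
    (hX01 : ∀ i, ∀ᵐ ω ∂P, X i ω ∈ Set.Icc (0 : ℝ) 1) (hindep : iIndepFun X P) {s : ℕ} (hs : s ≠ 0)
    (hpos : ∀ i, 0 < ∫ ω, X i ω ^ s ∂P) (t : ℝ) :
    P.real {ω | t ≤ ∑ i, X i ω} ≤ coeffPairing (fun k => max ((k : ℝ) / s - (t - 1)) 0)
      (bernoulliPGF (avgMomentRoot P X s) ^ (n * s)) := by
  set φ : ℝ → ℝ := fun x => max (x - (t - 1)) 0 with hφdef
  have hφ : ConvexOn ℝ Set.univ φ := convexOn_max_sub_zero (t - 1)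
  have hmono : Monotone φ := fun x y hxy => max_le_max (by linarith) le_rfl
  have hn0 : (n : ℝ) ≠ 0 := by exact_mod_cast hn
  have hs0 : (s : ℝ) ≠ 0 := by exact_mod_cast hs
  set p : Fin n → ℝ := fun i => (∫ ω, X i ω ^ s ∂P) ^ (1 / (s : ℝ)) with hpdef
  have hle : ∀ i, ∫ ω, X i ω ^ s ∂P ≤ 1 := fun i => by
    have h := integral_mono_of_nonneg (μ := P) (f := fun ω => X i ω ^ s) (g := fun _ => (1 : ℝ))
      ((hX01 i).mono fun ω h => pow_nonneg h.1 s) (integrable_const _)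
      ((hX01 i).mono fun ω h => pow_le_one₀ h.1 h.2)
    simpa using h
  have hp : ∀ i, p i ∈ Set.Ioc (0 : ℝ) 1 := fun i =>
    ⟨Real.rpow_pos_of_pos (hpos i) _, Real.rpow_le_one (hpos i).le (hle i) (by positivity)⟩
  have hmoment : ∀ i, ∫ ω, X i ω ^ s ∂P = p i ^ s := fun i => by
    rw [hpdef, one_div, Real.rpow_inv_natCast_pow (hpos i).le hs]
  have hsum : Measurable fun ω => ∑ i, X i ω := Finset.measurable_sum _ fun i _ => hX i
  have hint : Integrable (fun ω => φ (∑ i, X i ω)) P := by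
    refine hmono.integrable_comp_of_mem_Icc (a := 0) (b := ∑ _i : Fin n, 1) hsum ?_
    filter_upwards [ae_all_iff.2 hX01] with ω hω
    exact ⟨Finset.sum_nonneg fun i _ => (hω i).1, Finset.sum_le_sum fun i _ => (hω i).2⟩
  have hmarkov : P.real {ω | t ≤ ∑ i, X i ω} ≤ ∫ ω, φ (∑ i, X i ω) ∂P := by
    have h := mul_meas_ge_le_integral_of_nonneg (μ := P) (f := fun ω => φ (∑ i, X i ω))
      (Filter.Eventually.of_forall fun ω => le_max_right _ _) hint 1
    rw [one_mul] at h
    refine le_trans (measureReal_mono fun ω hω => ?_) h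
    have hω : t ≤ ∑ i, X i ω := hω
    exact le_max_of_le_left (by linarith : (1 : ℝ) ≤ ∑ i, X i ω - (t - 1))
  have hbin := integral_sum_le_coeffPairing_prod hφ hmono hX hX01 hindep hs hp hmoment Finset.univ 0
  simp only [add_zero] at hbin
  refine hmarkov.trans (hbin.trans ?_)
  have hconv : ∀ k : ℕ, 0 ≤ φ ((k + 2 : ℕ) / s) - 2 * φ ((k + 1 : ℕ) / s) + φ (k / s) := fun k => by
    have h := hφ.2 (Set.mem_univ ((k : ℝ) / s)) (Set.mem_univ (((k + 2 : ℕ) : ℝ) / s))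
      (by norm_num : (0 : ℝ) ≤ 1 / 2) (by norm_num : (0 : ℝ) ≤ 1 / 2) (by norm_num)
    have hmid : (1 / 2 : ℝ) • ((k : ℝ) / s) + (1 / 2 : ℝ) • (((k + 2 : ℕ) : ℝ) / s) =
        ((k + 1 : ℕ) : ℝ) / s := by
      simp only [smul_eq_mul]
      push_cast
      ring
    rw [hmid] at h
    simp only [smul_eq_mul] at h
    linarith
  have hq := avgMomentRoot_mem_unit P X hX01 s
  -- Each `p i` is taken `s` times, so the `n * s` probabilities have mean `q_s`.
  have hoeff := coeffPairing_prod_le_pow (f := fun k => φ (k / s)) hconv hq (n * s) (s • (Finset.univ.val.map p))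
    (by simp [mul_comm])
    (by
      rw [Multiset.sum_nsmul, avgMomentRoot]
      simp only [nsmul_eq_mul, Nat.cast_mul, hpdef, Finset.sum_map_val]
      field_simp)
    (by
      intro x hx
      obtain ⟨i, -, rfl⟩ := Multiset.mem_map.1 (Multiset.mem_of_mem_nsmul hx)
      exact ⟨(hp i).1.le, (hp i).2⟩)
    (R := 1) coeff_one_nonneg
  rw [one_mul, one_mul, Multiset.map_nsmul, Multiset.prod_nsmul, Multiset.map_map] at hoeff
  rw [Finset.prod_pow]
  exact hoeff

theorem mainTheorem10 {Ω : Type*} [MeasurableSpace Ω] (P : Measure Ω) [IsProbabilityMeasure P]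
    (n m : ℕ) (hn : 2 ≤ n) (hm : 2 ≤ m)
    (μ : Fin n → ℕ → ℝ)
    (hμ_lt : ∀ i, μ i 1 < 1)
    (hμ_anti : ∀ i, AntitoneOn (μ i) (Set.Icc 1 m))
    (hμ_pos : ∀ i, 0 < μ i m)
    (X : Fin n → Ω → ℝ)
    (hX : ∀ i, MemMomentClass P m (μ i) (X i))
    (hindep : iIndepFun X P)
    (t : ℕ) (ht_pos : 0 < t)
    (ht_lower : (n : ℝ) * avgMomentRoot P X 1 < (t : ℝ)) (ht_upper : t < n)
    (j : ℕ) (hj_one : 1 ≤ j) (hj_le : j ≤ m)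
    (htj : (t : ℝ) ∈ momentInterval n m (avgMomentRoot P X) j) :
    P.real {ω | (t : ℝ) ≤ ∑ i, X i ω} ≤
      (Finset.Icc 1 j).inf' (Finset.nonempty_Icc.mpr hj_one) (fun s : ℕ =>
        (((s : ℝ) * t - s + 1) * (1 - avgMomentRoot P X s)) /
            ((s : ℝ) * ((s : ℝ) * t - s + 1 - (n : ℝ) * s * avgMomentRoot P X s)) *
          binomialTail (n * s) (avgMomentRoot P X s) ((s : ℝ) * t - s + 1)) := by
  refine Finset.le_inf' _ _ fun s hs => ?_
  obtain ⟨hs1, hsj⟩ := Finset.mem_Icc.1 hs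
  have hXm := fun i => (hX i).measurable
  have hX01 := fun i => (hX i).mem_unit
  have hs1' : (1 : ℝ) ≤ s := by exact_mod_cast hs1
  have hn0 : (0 : ℝ) < n := by exact_mod_cast (by omega : 0 < n)
  have htj' : (n : ℝ) * avgMomentRoot P X j + 1 < t := by
    unfold momentInterval at htj
    split_ifs at htj with h
    · exact htj.1
    · obtain rfl : j = m := by omega
      exact htj.1
  have hqq : avgMomentRoot P X s ≤ avgMomentRoot P X j :=
    mul_le_mul_of_nonneg_left (Finset.sum_le_sum fun i _ =>
      integral_pow_rpow_one_div_mono (hXm i) (hX01 i) hs1 hsj) (by positivity)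
  have hq := avgMomentRoot_mem_unit P X hX01 s
  have hpos : ∀ i, 0 < ∫ ω, X i ω ^ s ∂P := fun i => by
    rw [(hX i).moment_eq s (Finset.mem_Icc.2 ⟨hs1, by omega⟩)]
    exact (hμ_pos i).trans_le
      (hμ_anti i ⟨hs1, by omega⟩ ⟨by omega, le_rfl⟩ (by omega))
  have hmain := prob_sum_ge_le_coeffPairing (by omega) hXm hX01 hindep (by omega) hpos t
  set q := avgMomentRoot P X s
  have hlt : (n : ℝ) * q + 1 < t :=
    lt_of_le_of_lt (by linarith [mul_le_mul_of_nonneg_left hqq hn0.le]) htj'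
  -- With `t = r + 1` the threshold `s t - s + 1` is the natural number `s r + 1`.
  obtain ⟨r, rfl⟩ : ∃ r, t = r + 1 := ⟨t - 1, by omega⟩
  have hT : (s : ℝ) * (r + 1 : ℕ) - s + 1 = (s * r + 1 : ℕ) := by push_cast; ring
  rw [hT]
  have htail := coeffPairing_excess_mul_le_binomialTail (N := n * s) (T := s * r + 1) hq
  -- Scaling by `s` turns `(k / s - r)⁺` into `(k - s r)⁺`, the excess over `T - 1` for `T = s r +
  -- 1`; this is the source of the factor `1 / s`.
  have hscale : coeffPairing (fun k => max ((k : ℝ) / s - ((r + 1 : ℕ) - 1)) 0)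
      (bernoulliPGF q ^ (n * s)) * s =
      coeffPairing (fun k => max ((k : ℝ) + 1 - (s * r + 1 : ℕ)) 0)
        (bernoulliPGF q ^ (n * s)) := by
    rw [coeffPairing_bernoulliPGF_pow, coeffPairing_bernoulliPGF_pow, Finset.sum_mul]
    refine Finset.sum_congr rfl fun k _ => ?_
    rw [mul_assoc, max_mul_of_nonneg _ _ (by positivity), zero_mul]
    congr 2
    push_cast
    field_simp
    ring
  have hden : (0 : ℝ) < ((s * r + 1 : ℕ) : ℝ) - n * s * q := by
    push_cast at hlt ⊢
    nlinarith
  refine hmain.trans ?_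
  rw [div_mul_eq_mul_div, le_div_iff₀ (by positivity), ← mul_assoc, hscale]
  simpa only [Nat.cast_mul] using htail
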